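/- Let $m\ge 1$ be odd and let $\mathbb R_{0,m}$ be the real Clifford algebra generated by $e_1,\dots,e_m$ with $e_j^2=-1$ and $e_je_l+e_le_j=0$ for $j\ne l$. For $x=(x_0,x_1,\dots,x_m)\in\mathbb R^{m+1}$ write $\underline x=\sum_{j=1}^m x_je_j$ (identified with $(x_1,\dots,x_m)\in\mathbb R^m$) and $r=|\underline x|$. Let $\partial_{\underline x}=\sum_{j=1}^m e_j\partial_{x_j}$ be the Dirac operator in $\mathbb R^m$ and $\Delta_x=\sum_{j=0}^m\partial_{x_j}^2$ the Laplacian in $\mathbb R^{m+1}$. For $k\ge0$ let $\mathbf P_k$ denote an $\mathbb R_{0,m}$-valued homogeneous polynomial of degree $k$ on $\mathbb R^m$ (possibly zero) which is monogenic, i.e. $\partial_{\underline x}\mathbf P_k=0$ in $\mathbb R^m$. Put $\beta_k(0)=1$ and, for $s\ge1$, $\beta_k(s)=s$ if $s$ is even and $\beta_k(s)=2k+m+s-1$ if $s$ is odd. For $n\ge 0$ define $$\mathsf M_n^k(x)=\left(\sum_{j=0}^n\binom nj\frac{(n-j)!}{\prod_{s=0}^{n-j}\beta_k(s)}\,x_0^j\,\underline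 x^{\,n-j}\right)\mathbf P_k(\underline x).$$ For $N\ge0$ write $(x_0+iy)^N=u(x_0,y)+i\,v(x_0,y)$ with $u,v$ real, and define $$\mathsf{Ft}\left[z^N,\mathbf P_k(\underline x)\right](x)=\Delta_x^{k+\frac{m-1}2}\left[\left(u(x_0,r)+\frac{\underline x}{r}\,v(x_0,r)\right)\mathbf P_k(\underline x)\right],$$ where the term $\frac{\underline x}{r}v(x_0,r)$ is read as $0$ at $\underline x=0$. Then for all integers $k,n\ge0$ there is a real constant $c\ne0$, depending only on $m$, $k$ and $n$, such that for every such $\mathbf P_k$ and all $x\in\mathbb R^{m+1}$ $$\mathsf M_n^k(x)=c\;\mathsf{Ft}\left[z^{\,n+2k+m-1},\mathbf P_k(\underline x)\right](x).$$ -/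

import Mathlib

/-- The quadratic form `v ↦ -∑ v_j²` on `ℝ^m`. -/
abbrev negSumSq (m : ℕ) : QuadraticForm ℝ (Fin m → ℝ) :=
  QuadraticMap.weightedSumSquares ℝ (fun _ : Fin m => (-1 : ℝ))

/-- The real Clifford algebra `ℝ_{0,m}`: generated by `e_1, …, e_m` with
`e_j² = -1` and `e_j e_k + e_k e_j = 0` for `j ≠ k`. -/
abbrev Cl (m : ℕ) : Type := CliffordAlgebra (negSumSq m)

namespace Cl

/-- The generator `e_j` of `ℝ_{0,m}`. -/
noncomputable def e {m : ℕ} (j : Fin m) : Cl m :=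
  CliffordAlgebra.ι (negSumSq m) (Pi.single j 1)

/-- The real basis of `ℝ_{0,m}` indexed by the subsets `A` of `{1, …, m}` (so `ℝ_{0,m}` has
dimension `2^m`), obtained from the basis `e_{j_1} ∧ … ∧ e_{j_k}` of the exterior algebra. -/
noncomputable def basis (m : ℕ) : Module.Basis (Finset (Fin m)) ℝ (Cl m) :=
  (Pi.basisFun ℝ (Fin m)).ExteriorAlgebra.map (CliffordAlgebra.equivExterior (negSumSq m)).symm

/-- The coefficients of `a = ∑_A a_A e_A` as a vector of a Euclidean space. -/
noncomputable def coeffs (m : ℕ) : Cl m →ₗ[ℝ] EuclideanSpace ℝ (Finset (Fin m)) :=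
  (WithLp.linearEquiv 2 ℝ (Finset (Fin m) → ℝ)).symm.toLinearMap ∘ₗ
    (basis m).equivFun.toLinearMap

theorem coeffs_injective (m : ℕ) : Function.Injective (coeffs m) :=
  (WithLp.linearEquiv 2 ℝ (Finset (Fin m) → ℝ)).symm.injective.comp (basis m).equivFun.injective

/-- The coefficient norm `|a|² = ∑_A a_A²` on `ℝ_{0,m}`. It is used only to speak of derivatives
of `ℝ_{0,m}`-valued functions, for which the choice of a norm on this finite-dimensional space is
irrelevant. -/
noncomputable instance (m : ℕ) : NormedAddCommGroup (Cl m) :=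
  NormedAddCommGroup.induced (Cl m) (EuclideanSpace ℝ (Finset (Fin m))) (coeffs m)
    (coeffs_injective m)

noncomputable instance (m : ℕ) : NormedSpace ℝ (Cl m) :=
  NormedSpace.induced ℝ (Cl m) (EuclideanSpace ℝ (Finset (Fin m))) (coeffs m)

instance (m : ℕ) : FiniteDimensional ℝ (Cl m) := (basis m).finiteDimensional_of_finite

/-- The embedding `x̲ ↦ ∑_j x_j e_j` of `ℝ^m` into `ℝ_{0,m}`. -/
noncomputable def vec {m : ℕ} (y : EuclideanSpace ℝ (Fin m)) : Cl m :=
  ∑ j, y j • e j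

end Cl

/-- The vector part `x̲ = (x_1, …, x_m)` of `x = (x_0, x_1, …, x_m)`. -/
def vecPart {m : ℕ} (x : EuclideanSpace ℝ (Fin (m + 1))) : EuclideanSpace ℝ (Fin m) :=
  WithLp.toLp 2 fun j => x j.succ

/-- The Dirac operator `∂_x̲ = ∑_j e_j ∂_{x_j}` in `ℝ^m`, acting from the left. -/
noncomputable def dirac {m : ℕ} (g : EuclideanSpace ℝ (Fin m) → Cl m)
    (y : EuclideanSpace ℝ (Fin m)) : Cl m :=
  ∑ j, Cl.e j * fderiv ℝ g y (EuclideanSpace.single j 1)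

/-- `g : ℝ^m → ℝ_{0,m}` is a polynomial function `∑_α x^α a_α` with coefficients
`a_α ∈ ℝ_{0,m}` (finitely many nonzero). -/
def IsCliffordPolynomial {m : ℕ} (g : EuclideanSpace ℝ (Fin m) → Cl m) : Prop :=
  ∃ a : (Fin m →₀ ℕ) →₀ Cl m, ∀ y, g y = a.sum fun α b => (∏ j, y j ^ α j) • b

/-- `P` is an `ℝ_{0,m}`-valued homogeneous polynomial of degree `k` that is (left) monogenic
in `ℝ^m`. The zero polynomial is allowed. -/
structure IsHomogeneousMonogenic {m : ℕ} (k : ℕ) (P : EuclideanSpace ℝ (Fin m) → Cl m) :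
    Prop where
  polynomial : IsCliffordPolynomial P
  homogeneous : ∀ (t : ℝ) (y : EuclideanSpace ℝ (Fin m)), P (t • y) = t ^ k • P y
  monogenic : ∀ y, dirac P y = 0

/-- `β_k(0) = 1`, and for `n ≥ 1`: `β_k(n) = n` for even `n`, `β_k(n) = 2k + m + n - 1` for
odd `n`. -/
def beta (m k n : ℕ) : ℕ :=
  if n = 0 then 1 else if Even n then n else 2 * k + m + n - 1

/-- `C_{k,n}(j) = (n-j)! / ∏_{s=0}^{n-j} β_k(s)` for `0 ≤ j ≤ n`. -/
noncomputable def appellCoeff (m k n j : ℕ) : ℝ :=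
  ((n - j).factorial : ℝ) / ∏ s ∈ Finset.range (n - j + 1), (beta m k s : ℝ)

/-- `M_n^k(x) = (∑_{j=0}^n binom(n,j) C_{k,n}(j) x_0^j x̲^{n-j}) P_k(x̲)`. -/
noncomputable def appellM {m : ℕ} (k n : ℕ) (P : EuclideanSpace ℝ (Fin m) → Cl m)
    (x : EuclideanSpace ℝ (Fin (m + 1))) : Cl m :=
  (∑ j ∈ Finset.range (n + 1),
    ((n.choose j : ℝ) * appellCoeff m k n j * x 0 ^ j) • Cl.vec (vecPart x) ^ (n - j)) *
    P (vecPart x)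

/-- `(u(x_0,r) + ω̲ v(x_0,r)) P(x̲)` with `f = u + i v`, `r = |x̲|` and `ω̲ = x̲ / r`.
At `x̲ = 0` the term `ω̲ v` is read as `0`. -/
noncomputable def fueterInput {m : ℕ} (f : ℂ → ℂ) (P : EuclideanSpace ℝ (Fin m) → Cl m)
    (x : EuclideanSpace ℝ (Fin (m + 1))) : Cl m :=
  (algebraMap ℝ (Cl m) (f ⟨x 0, ‖vecPart x‖⟩).re +
    (f ⟨x 0, ‖vecPart x‖⟩).im • (‖vecPart x‖⁻¹ • Cl.vec (vecPart x))) * P (vecPart x)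

/-- `Ft[f, P_k](x) = Δ_x^{k+(m-1)/2} [(u(x_0,r) + ω̲ v(x_0,r)) P_k(x̲)]`, for odd `m`, where
`Δ_x` is the Laplacian of `ℝ^{m+1}`. -/
noncomputable def fueter {m : ℕ} (k : ℕ) (f : ℂ → ℂ) (P : EuclideanSpace ℝ (Fin m) → Cl m) :
    EuclideanSpace ℝ (Fin (m + 1)) → Cl m :=
  (Laplacian.laplacian : (EuclideanSpace ℝ (Fin (m + 1)) → Cl m) →
    EuclideanSpace ℝ (Fin (m + 1)) → Cl m)^[k + (m - 1) / 2] (fueterInput f P)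

/-!
Put `h = k + (m - 1) / 2`, so that `2k + m = 2h + 1`, and let
`T_{a,b} = (x_0^a / a!) · x̲^b P(x̲) / (β_k(0) ⋯ β_k(b))`.

Since `x̲² = -r²`, the function to which the Laplacian is applied is `(x_0 + x̲)^N P(x̲)` with
`N = n + 2h` (`fueterInput_pow`). By the binomial theorem it equals
`N! ∑_{a+b=N} q(b) T_{a,b}` with `q(b) = β_k(0) ⋯ β_k(b) / b!`, while the Appell polynomial is
`n! ∑_{a+b=n} T_{a,b}`.

The commutation rules `∂_x̲ x̲ = -m - x̲ ∂_x̲ - 2E` (with `E` the Euler operator) and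
`Δ x̲ = x̲ Δ + 2 ∂_x̲` give `∂_x̲ (x̲^b P) = -β_k(b) x̲^{b-1} P` for
`b ≥ 1` and `Δ (x̲^b P) = -β_k(b-1) β_k(b) x̲^{b-2} P` for `b ≥ 2`, while `P` and `x̲ P` are
harmonic because `P` is monogenic. Hence `Δ_x T_{a,b} = T_{a-2,b} - T_{a,b-2}`, with terms of negative index read as
zero, and on a sum `∑_{a+b=M} q(b) T_{a,b}` the Laplacian replaces the weight `q(b)` by
`q(b) - q(b+2)` (`IsHomogeneousMonogenic.laplacian_weightedSum`).

Finally `q(b) = p(⌈b/2⌉)` for the polynomial `p(t) = ∏_{l<h} (2t + 2l + 1) / (2l + 1)`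
of degree `h` (`betaProd_div_factorial`). So `Δ_x^h` replaces `q` by `(-1)^h` times the `h`-th
forward difference of `p`, which is the nonzero constant `h!` times the leading coefficient of `p`.
-/

open scoped ContDiff
open Finset Laplacian

/-! ### Relations in the Clifford algebra -/

namespace Cl

variable {m : ℕ}

theorem vec_eq_ι (y : EuclideanSpace ℝ (Fin m)) :
    vec y = CliffordAlgebra.ι (negSumSq m) y.ofLp := by
  conv_rhs => rw [← (Pi.basisFun ℝ (Fin m)).sum_repr y.ofLp, map_sum]
  simp [vec, e]

theorem vec_single (j : Fin m) : vec (EuclideanSpace.single j 1) = (e j : Cl m) := by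
  rw [vec_eq_ι, e]; rfl

theorem vec_mul_vec_self (y : EuclideanSpace ℝ (Fin m)) :
    vec y * vec y = algebraMap ℝ (Cl m) (-‖y‖ ^ 2) := by
  rw [vec_eq_ι, CliffordAlgebra.ι_sq_scalar, EuclideanSpace.real_norm_sq_eq]
  simp [QuadraticMap.weightedSumSquares_apply, sq]

theorem e_mul_e_self (j : Fin m) : (e j * e j : Cl m) = -1 := by
  rw [← vec_single, vec_mul_vec_self]; simp

theorem e_mul_vec_add_vec_mul_e (j : Fin m) (y : EuclideanSpace ℝ (Fin m)) :
    e j * vec y + vec y * e j = algebraMap ℝ (Cl m) (-2 * y j) := by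
  rw [vec_eq_ι, e, CliffordAlgebra.ι_mul_ι_add_swap]
  congr 1
  simp only [QuadraticMap.polar, QuadraticMap.weightedSumSquares_apply, Pi.add_apply,
    ← Finset.sum_sub_distrib]
  rw [Finset.sum_eq_single j]
  · simp; ring
  · intro i _ hi
    simp [Pi.single_eq_of_ne hi]
  · simp

theorem e_mul_e_add_e_mul_e (i j : Fin m) :
    (e i * e j + e j * e i : Cl m) = if i = j then -2 else 0 := by
  rw [← vec_single j, e_mul_vec_add_vec_mul_e]
  by_cases h : i = j
  · simp [h, Algebra.algebraMap_eq_smul_one, ofNat_smul_eq_nsmul]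
  · simp [h]

/-- Clifford multiplication as a continuous bilinear map. -/
noncomputable def mulL (m : ℕ) : Cl m →L[ℝ] Cl m →L[ℝ] Cl m :=
  (LinearMap.mul ℝ (Cl m)).toContinuousBilinearMap

theorem mulL_apply (a b : Cl m) : mulL m a b = a * b := rfl

/-- The embedding `Cl.vec` as a continuous linear map. -/
noncomputable def vecL (m : ℕ) : EuclideanSpace ℝ (Fin m) →L[ℝ] Cl m :=
  LinearMap.toContinuousLinearMap
    (CliffordAlgebra.ι (negSumSq m) ∘ₗ (WithLp.linearEquiv 2 ℝ (Fin m → ℝ)).toLinearMap)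

theorem vecL_apply (y : EuclideanSpace ℝ (Fin m)) : vecL m y = vec y := (vec_eq_ι y).symm

end Cl

variable {m : ℕ}

/-! ### Derivatives of Clifford-valued functions -/

theorem contDiff_vec_mul {g : EuclideanSpace ℝ (Fin m) → Cl m} (hg : ContDiff ℝ ∞ g) :
    ContDiff ℝ ∞ fun y => Cl.vec y * g y := by
  have h := ((Cl.mulL m).contDiff.comp (Cl.vecL m).contDiff).clm_apply hg
  simpa only [Function.comp_def, Cl.vecL_apply, Cl.mulL_apply] using h

theorem fderiv_vec_mul {g : EuclideanSpace ℝ (Fin m) → Cl m}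
    {y : EuclideanSpace ℝ (Fin m)} (hg : DifferentiableAt ℝ g y)
    (v : EuclideanSpace ℝ (Fin m)) :
    fderiv ℝ (fun y => Cl.vec y * g y) y v = Cl.vec v * g y + Cl.vec y * fderiv ℝ g y v := by
  have h := (Cl.mulL m).hasFDerivAt_of_bilinear (Cl.vecL m).hasFDerivAt hg.hasFDerivAt
  simp only [Cl.vecL_apply, Cl.mulL_apply] at h
  rw [h.fderiv]
  simp [Cl.vecL_apply, Cl.mulL_apply, add_comm]

theorem fderiv_const_mul_cl {F : Type*} [NormedAddCommGroup F] [NormedSpace ℝ F]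
    {g : F → Cl m} {y : F} (hg : DifferentiableAt ℝ g y) (a : Cl m) (v : F) :
    fderiv ℝ (fun y => a * g y) y v = a * fderiv ℝ g y v := by
  have h := (Cl.mulL m a).hasFDerivAt.comp y hg.hasFDerivAt
  simp only [Function.comp_def, Cl.mulL_apply] at h
  rw [h.fderiv]
  simp [Cl.mulL_apply]

theorem ContDiff.fderiv_apply_const {F G : Type*} [NormedAddCommGroup F] [NormedSpace ℝ F]
    [NormedAddCommGroup G] [NormedSpace ℝ G] {g : F → G} (hg : ContDiff ℝ ∞ g) (v : F) :
    ContDiff ℝ ∞ fun y => fderiv ℝ g y v :=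
  (hg.fderiv_right (by simp)).clm_apply contDiff_const

theorem fderiv_fderiv_apply_const {F G : Type*} [NormedAddCommGroup F] [NormedSpace ℝ F]
    [NormedAddCommGroup G] [NormedSpace ℝ G] {g : F → G} (hg : ContDiff ℝ ∞ g) (y v w : F) :
    fderiv ℝ (fun y => fderiv ℝ g y v) y w = fderiv ℝ (fderiv ℝ g) y w v := by
  have h : DifferentiableAt ℝ (fderiv ℝ g) y :=
    (hg.fderiv_right (m := ∞) (by simp)).differentiable (by simp) y
  rw [fderiv_clm_apply h (differentiableAt_const v)]
  simp

theorem laplacian_eq_sum_fderiv {d : ℕ} {G : Type*} [NormedAddCommGroup G] [NormedSpace ℝ G]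
    {g : EuclideanSpace ℝ (Fin d) → G} (hg : ContDiff ℝ ∞ g) (y : EuclideanSpace ℝ (Fin d)) :
    Δ g y = ∑ i, fderiv ℝ (fun z => fderiv ℝ g z (EuclideanSpace.single i 1)) y
      (EuclideanSpace.single i 1) := by
  rw [InnerProductSpace.laplacian_eq_iteratedFDeriv_orthonormalBasis g
    (EuclideanSpace.basisFun (Fin d) ℝ)]
  simp only [fderiv_fderiv_apply_const hg, iteratedFDeriv_two_apply]
  simp

/-! ### The Dirac operator and the Laplacian -/

/-- A function annihilated by the Dirac operator is harmonic, because `∂_x̲² = -Δ`. -/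
theorem laplacian_eq_zero_of_dirac_eq_zero {g : EuclideanSpace ℝ (Fin m) → Cl m}
    (hg : ContDiff ℝ ∞ g) (h : ∀ y, dirac g y = 0) (y : EuclideanSpace ℝ (Fin m)) :
    Δ g y = 0 := by
  set A : Fin m → Fin m → Cl m := fun i j =>
    fderiv ℝ (fderiv ℝ g) y (EuclideanSpace.single i 1) (EuclideanSpace.single j 1) with hA
  have hsymm : ∀ i j, A i j = A j i := fun i j =>
    (hg.contDiffAt.isSymmSndFDerivAt (by
      rw [minSmoothness_of_isRCLikeNormedField]; exact ENat.LEInfty.out)).eq _ _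
  -- Differentiate `∂_x̲ g = 0` in the direction `e_i`.
  have hrow : ∀ i, ∑ j, Cl.e j * A i j = 0 := by
    intro i
    have h0 : fderiv ℝ (dirac g) y (EuclideanSpace.single i 1) = 0 := by
      rw [show dirac g = fun _ => 0 from funext h]; simp
    have hd : ∀ j, DifferentiableAt ℝ (fun z => fderiv ℝ g z (EuclideanSpace.single j 1)) y :=
      fun j => (hg.fderiv_apply_const _).differentiable (by simp) y
    have hd' : ∀ j, DifferentiableAt ℝ
        (fun z => (Cl.e j : Cl m) * fderiv ℝ g z (EuclideanSpace.single j 1)) y :=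
      fun j => (Cl.mulL m (Cl.e j)).differentiableAt.comp y (hd j)
    rw [show dirac g = fun z => ∑ j, Cl.e j * fderiv ℝ g z (EuclideanSpace.single j 1) from rfl,
      fderiv_fun_sum fun j _ => hd' j] at h0
    simpa [fderiv_const_mul_cl (hd _), fderiv_fderiv_apply_const hg] using h0
  -- The double sum is `∂_x̲² g`; symmetrising it leaves only the diagonal terms.
  have hS : ∑ i, ∑ j, (Cl.e i * Cl.e j : Cl m) * A i j = 0 :=
    Finset.sum_eq_zero fun i _ => by
      simp only [mul_assoc, ← Finset.mul_sum, hrow i, mul_zero]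
  have hS' : ∑ i, ∑ j, (Cl.e j * Cl.e i : Cl m) * A i j = 0 := by
    rw [Finset.sum_comm, ← hS]
    exact Finset.sum_congr rfl fun i _ => Finset.sum_congr rfl fun j _ => by rw [hsymm]
  have h2 : ∑ i, (-2 : Cl m) * A i i = 0 := by
    have := congrArg₂ (· + ·) hS hS'
    simp only [← Finset.sum_add_distrib, ← add_mul, Cl.e_mul_e_add_e_mul_e] at this
    simpa using this
  rw [← Finset.mul_sum] at h2
  rw [laplacian_eq_sum_fderiv hg]
  simp only [fderiv_fderiv_apply_const hg]
  have h3 : (-2 : ℝ) • ∑ i, A i i = 0 := by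
    rw [← h2, neg_smul, ofNat_smul_eq_nsmul, neg_mul]; simp
  exact (smul_eq_zero.1 h3).resolve_left (by norm_num)

/-- The commutation rule `Δ x̲ = x̲ Δ + 2 ∂_x̲`. -/
theorem laplacian_vec_mul {g : EuclideanSpace ℝ (Fin m) → Cl m} (hg : ContDiff ℝ ∞ g)
    (y : EuclideanSpace ℝ (Fin m)) :
    Δ (fun y => Cl.vec y * g y) y = Cl.vec y * Δ g y + (2 : ℝ) • dirac g y := by
  have hd : ∀ y, DifferentiableAt ℝ g y := fun y => hg.differentiable (by simp) y
  have hd' : ∀ v y, DifferentiableAt ℝ (fun z => fderiv ℝ g z v) y := fun v y =>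
    (hg.fderiv_apply_const v).differentiable (by simp) y
  rw [laplacian_eq_sum_fderiv (contDiff_vec_mul hg), laplacian_eq_sum_fderiv hg, dirac,
    Finset.mul_sum, Finset.smul_sum, ← Finset.sum_add_distrib]
  refine Finset.sum_congr rfl fun i _ => ?_
  simp only [fderiv_vec_mul (hd _)]
  have h1 := (Cl.mulL m (Cl.e i)).differentiableAt.comp y (hd y)
  have h2 := (contDiff_vec_mul
    (hg.fderiv_apply_const (EuclideanSpace.single i 1))).differentiable (by simp) y
  simp only [Function.comp_def, Cl.mulL_apply] at h1
  rw [Cl.vec_single, fderiv_fun_add h1 h2]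
  simp only [_root_.add_apply]
  rw [fderiv_const_mul_cl (hd y), fderiv_vec_mul (hd' _ y), Cl.vec_single, two_smul]
  abel

/-- The commutation rule `∂_x̲ x̲ = -m - x̲ ∂_x̲ - 2E`, with `E` the Euler operator. -/
theorem dirac_vec_mul {g : EuclideanSpace ℝ (Fin m) → Cl m} (hg : ContDiff ℝ ∞ g)
    (y : EuclideanSpace ℝ (Fin m)) :
    dirac (fun y => Cl.vec y * g y) y
      = -((m : ℝ) • g y) - Cl.vec y * dirac g y - (2 : ℝ) • fderiv ℝ g y y := by
  have hd : DifferentiableAt ℝ g y := hg.differentiable (by simp) y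
  have hy : fderiv ℝ g y y = ∑ j, y j • fderiv ℝ g y (EuclideanSpace.single j 1) := by
    have := congrArg (fderiv ℝ g y) ((EuclideanSpace.basisFun (Fin m) ℝ).sum_repr y)
    rw [← this, map_sum]
    simp
  have hterm : ∀ j : Fin m, Cl.e j * fderiv ℝ (fun y => Cl.vec y * g y) y
      (EuclideanSpace.single j 1) = -g y
        - Cl.vec y * (Cl.e j * fderiv ℝ g y (EuclideanSpace.single j 1))
        - (2 : ℝ) • y j • fderiv ℝ g y (EuclideanSpace.single j 1) := by
    intro j
    have hc : Cl.e j * Cl.vec y = -(Cl.vec y * Cl.e j) + algebraMap ℝ (Cl m) (-2 * y j) := by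
      rw [← Cl.e_mul_vec_add_vec_mul_e]; abel
    rw [fderiv_vec_mul hd, Cl.vec_single, mul_add, ← mul_assoc, Cl.e_mul_e_self, ← mul_assoc, hc,
      add_mul, ← Algebra.smul_def, smul_smul, neg_mul, neg_mul, one_mul, mul_assoc, neg_mul,
      neg_smul]
    abel
  simp only [dirac, hterm, Finset.sum_sub_distrib, ← Finset.mul_sum, ← Finset.smul_sum, ← hy]
  simp [Nat.cast_smul_eq_nsmul]

/-- Euler's identity for homogeneous functions. -/
theorem fderiv_apply_self_of_homogeneous {d : ℕ} {G : Type*} [NormedAddCommGroup G]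
    [NormedSpace ℝ G] {g : EuclideanSpace ℝ (Fin d) → G} {l : ℕ} (hg : Differentiable ℝ g)
    (h : ∀ (t : ℝ) y, g (t • y) = t ^ l • g y) (y : EuclideanSpace ℝ (Fin d)) :
    fderiv ℝ g y y = (l : ℝ) • g y := by
  have h1 : HasDerivAt (fun t : ℝ => g (t • y)) (fderiv ℝ g y y) 1 := by
    have hs : HasDerivAt (fun t : ℝ => t • y) y 1 := by
      simpa using (hasDerivAt_id (1 : ℝ)).smul_const y
    have hg1 : HasFDerivAt g (fderiv ℝ g y) ((1 : ℝ) • y) := by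
      rw [one_smul]; exact (hg y).hasFDerivAt
    exact hg1.comp_hasDerivAt (1 : ℝ) hs
  have h2 : HasDerivAt (fun t : ℝ => g (t • y)) ((l : ℝ) • g y) 1 := by
    simp only [h]
    simpa using (hasDerivAt_pow l (1 : ℝ)).smul_const (g y)
  exact h1.unique h2

theorem IsCliffordPolynomial.contDiff {g : EuclideanSpace ℝ (Fin m) → Cl m}
    (h : IsCliffordPolynomial g) : ContDiff ℝ ∞ g := by
  obtain ⟨a, ha⟩ := h
  rw [show g = _ from funext ha]
  unfold Finsupp.sum
  refine ContDiff.sum fun α _ => ContDiff.smul (f := fun y : EuclideanSpace ℝ (Fin m) =>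
    ∏ j, y j ^ α j) (g := fun _ => a α) ?_ contDiff_const
  have hj : ∀ j : Fin m, ContDiff ℝ ∞ fun y : EuclideanSpace ℝ (Fin m) => y j := fun j =>
    (EuclideanSpace.proj (𝕜 := ℝ) j).contDiff
  exact contDiff_prod fun j _ => (hj j).pow (α j)

/-! ### Powers of the vector variable times a monogenic polynomial -/

/-- The recursion which the commutation rule `dirac_vec_mul` imposes on the factors in
`∂_x̲ (x̲^b P) = -β_k(b) x̲^{b-1} P`. -/
theorem beta_succ_add_beta_succ_succ (k b : ℕ) :
    beta m k (b + 1) + beta m k (b + 2) = m + 2 * (k + (b + 1)) := by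
  rcases Nat.even_or_odd b with h | h
  · have h1 : ¬ Even (b + 1) := by simpa [Nat.even_add_one] using h
    have h2 : Even (b + 2) := by simpa [Nat.even_add] using h
    simp only [beta, h1, h2]; simp; omega
  · have h1 : Even (b + 1) := h.add_one
    have h2 : ¬ Even (b + 2) := by simpa [Nat.even_add] using h
    simp only [beta, h1, h2]; simp; omega

theorem beta_one (k : ℕ) : beta m k 1 = 2 * k + m := by simp [beta]

theorem beta_two (k : ℕ) : beta m k 2 = 2 := by simp [beta]

theorem beta_pos (hm : 0 < m) (k s : ℕ) : 0 < beta m k s := by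
  unfold beta; split_ifs <;> omega

namespace IsHomogeneousMonogenic

variable {k : ℕ} {P : EuclideanSpace ℝ (Fin m) → Cl m}

theorem contDiff_vec_pow_mul (hP : IsHomogeneousMonogenic k P) (b : ℕ) :
    ContDiff ℝ ∞ fun y => Cl.vec y ^ b * P y := by
  induction b with
  | zero => simpa using hP.polynomial.contDiff
  | succ b ih => simpa only [pow_succ', mul_assoc] using contDiff_vec_mul ih

theorem homogeneous_vec_pow_mul (hP : IsHomogeneousMonogenic k P) (b : ℕ) (t : ℝ)
    (y : EuclideanSpace ℝ (Fin m)) :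
    Cl.vec (t • y) ^ b * P (t • y) = t ^ (k + b) • (Cl.vec y ^ b * P y) := by
  rw [← Cl.vecL_apply, map_smul, smul_pow, hP.homogeneous, smul_mul_smul_comm, ← pow_add,
    Cl.vecL_apply, add_comm]

theorem dirac_vec_pow_succ_mul (hP : IsHomogeneousMonogenic k P) (b : ℕ)
    (y : EuclideanSpace ℝ (Fin m)) :
    dirac (fun y => Cl.vec y ^ (b + 1) * P y) y
      = -((beta m k (b + 1) : ℝ) • (Cl.vec y ^ b * P y)) := by
  have hrec : ∀ b : ℕ, dirac (fun y => Cl.vec y ^ (b + 1) * P y) y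
      = -((m + 2 * (k + b) : ℝ) • (Cl.vec y ^ b * P y))
        - Cl.vec y * dirac (fun y => Cl.vec y ^ b * P y) y := by
    intro b
    simp only [pow_succ', mul_assoc]
    rw [dirac_vec_mul (hP.contDiff_vec_pow_mul b), fderiv_apply_self_of_homogeneous
      ((hP.contDiff_vec_pow_mul b).differentiable (by simp)) (hP.homogeneous_vec_pow_mul b),
      smul_smul, add_smul]
    push_cast
    abel
  induction b with
  | zero =>
    rw [hrec]
    simp only [pow_zero, one_mul]
    rw [show dirac (fun y => P y) y = 0 from hP.monogenic y, beta_one, mul_zero, sub_zero]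
    push_cast
    congr 2
    ring
  | succ b ih =>
    have hb : (beta m k (b + 1) : ℝ) + beta m k (b + 2) = m + 2 * (k + (b + 1)) := by
      exact_mod_cast beta_succ_add_beta_succ_succ k b
    rw [hrec, ih, mul_neg, mul_smul_comm, ← mul_assoc, ← pow_succ', Nat.cast_succ, ← hb, add_smul]
    abel

theorem laplacian_eq_zero (hP : IsHomogeneousMonogenic k P) (y : EuclideanSpace ℝ (Fin m)) :
    Δ P y = 0 :=
  laplacian_eq_zero_of_dirac_eq_zero hP.polynomial.contDiff hP.monogenic y

theorem laplacian_vec_mul_eq_zero (hP : IsHomogeneousMonogenic k P) (y : EuclideanSpace ℝ (Fin m)) :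
    Δ (fun y => Cl.vec y * P y) y = 0 := by
  rw [laplacian_vec_mul hP.polynomial.contDiff, hP.laplacian_eq_zero, hP.monogenic]
  simp

theorem laplacian_vec_pow_add_two_mul (hP : IsHomogeneousMonogenic k P) (b : ℕ)
    (y : EuclideanSpace ℝ (Fin m)) :
    Δ (fun y => Cl.vec y ^ (b + 2) * P y) y
      = -((beta m k (b + 1) * beta m k (b + 2) : ℝ) • (Cl.vec y ^ b * P y)) := by
  have hrec : ∀ b : ℕ, Δ (fun y => Cl.vec y ^ (b + 2) * P y) y
      = Cl.vec y * Δ (fun y => Cl.vec y ^ (b + 1) * P y) y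
        - (2 * beta m k (b + 1) : ℝ) • (Cl.vec y ^ b * P y) := by
    intro b
    rw [show (fun y => Cl.vec y ^ (b + 2) * P y)
      = fun y => Cl.vec y * (Cl.vec y ^ (b + 1) * P y) by
        simp only [pow_succ' _ (b + 1), mul_assoc],
      laplacian_vec_mul (hP.contDiff_vec_pow_mul _), hP.dirac_vec_pow_succ_mul,
      smul_neg, smul_smul, sub_eq_add_neg]
  induction b with
  | zero =>
    rw [hrec]
    simp only [zero_add, pow_one, pow_zero, one_mul]
    rw [hP.laplacian_vec_mul_eq_zero, beta_two, mul_zero, zero_sub]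
    push_cast
    rw [mul_comm]
  | succ b ih =>
    have hb : (beta m k (b + 3) : ℝ) = beta m k (b + 1) + 2 := by
      have h1 := beta_succ_add_beta_succ_succ (m := m) k b
      have h2 := beta_succ_add_beta_succ_succ (m := m) k (b + 1)
      have h3 : beta m k (b + 3) = beta m k (b + 1) + 2 := by
        simp only [add_assoc, Nat.reduceAdd] at h1 h2
        omega
      exact_mod_cast h3
    rw [hrec, ih, mul_neg, mul_smul_comm, ← mul_assoc, ← pow_succ', ← neg_add', ← add_smul, hb]
    congr 2
    ring

end IsHomogeneousMonogenic

/-! ### The Laplacian of products of functions of `x_0` and of `x̲` -/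

/-- The projection `vecPart` as a continuous linear map. -/
noncomputable def vecPartL (m : ℕ) :
    EuclideanSpace ℝ (Fin (m + 1)) →L[ℝ] EuclideanSpace ℝ (Fin m) :=
  LinearMap.toContinuousLinearMap
    { toFun := vecPart
      map_add' := fun _ _ => rfl
      map_smul' := fun _ _ => rfl }

theorem vecPartL_apply (x : EuclideanSpace ℝ (Fin (m + 1))) : vecPartL m x = vecPart x := rfl

theorem vecPart_single_zero : vecPart (EuclideanSpace.single (0 : Fin (m + 1)) (1 : ℝ)) = 0 := by
  ext j; simp [vecPart]

theorem vecPart_single_succ (i : Fin m) :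
    vecPart (EuclideanSpace.single i.succ (1 : ℝ)) = EuclideanSpace.single i 1 := by
  ext j; simp [vecPart]

theorem contDiff_smul_comp_vecPart {G : Type*} [NormedAddCommGroup G] [NormedSpace ℝ G]
    {f : ℝ → ℝ} {φ : EuclideanSpace ℝ (Fin m) → G} (hf : ContDiff ℝ ∞ f) (hφ : ContDiff ℝ ∞ φ) :
    ContDiff ℝ ∞ fun x : EuclideanSpace ℝ (Fin (m + 1)) => f (x 0) • φ (vecPart x) :=
  (hf.comp (EuclideanSpace.proj (𝕜 := ℝ) (0 : Fin (m + 1))).contDiff).smul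
    (hφ.comp (vecPartL m).contDiff)

theorem fderiv_smul_comp_vecPart {G : Type*} [NormedAddCommGroup G] [NormedSpace ℝ G]
    {f : ℝ → ℝ} {φ : EuclideanSpace ℝ (Fin m) → G} (hf : ContDiff ℝ ∞ f) (hφ : ContDiff ℝ ∞ φ)
    (x v : EuclideanSpace ℝ (Fin (m + 1))) :
    fderiv ℝ (fun x => f (x 0) • φ (vecPart x)) x v
      = (v 0 * deriv f (x 0)) • φ (vecPart x)
        + f (x 0) • fderiv ℝ φ (vecPart x) (vecPart v) := by
  have h1 : HasFDerivAt (fun x : EuclideanSpace ℝ (Fin (m + 1)) => f (x 0)) _ x :=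
    ((hf.differentiable (by simp) (x 0)).hasDerivAt.hasFDerivAt).comp x
      (EuclideanSpace.proj (𝕜 := ℝ) (0 : Fin (m + 1))).hasFDerivAt
  have h2 : HasFDerivAt (fun x : EuclideanSpace ℝ (Fin (m + 1)) => φ (vecPart x)) _ x :=
    ((hφ.differentiable (by simp) (vecPart x)).hasFDerivAt).comp x (vecPartL m).hasFDerivAt
  rw [(h1.fun_smul h2).fderiv]
  simp [vecPartL_apply, add_comm]

theorem laplacian_smul_comp_vecPart {G : Type*} [NormedAddCommGroup G] [NormedSpace ℝ G]
    {f : ℝ → ℝ} {φ : EuclideanSpace ℝ (Fin m) → G} (hf : ContDiff ℝ ∞ f) (hφ : ContDiff ℝ ∞ φ)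
    (x : EuclideanSpace ℝ (Fin (m + 1))) :
    Δ (fun x : EuclideanSpace ℝ (Fin (m + 1)) => f (x 0) • φ (vecPart x)) x
      = deriv (deriv f) (x 0) • φ (vecPart x) + f (x 0) • Δ φ (vecPart x) := by
  have hf' : ContDiff ℝ ∞ (deriv f) := by
    simpa using (contDiff_infty_iff_deriv.1 hf).2
  rw [laplacian_eq_sum_fderiv (contDiff_smul_comp_vecPart hf hφ), Fin.sum_univ_succ,
    laplacian_eq_sum_fderiv hφ, Finset.smul_sum]
  simp only [fderiv_smul_comp_vecPart hf hφ, vecPart_single_zero, vecPart_single_succ, map_zero,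
    smul_zero, add_zero]
  congr 1
  · simp [fderiv_smul_comp_vecPart hf' hφ, vecPart_single_zero]
  · refine Finset.sum_congr rfl fun i _ => ?_
    simp [fderiv_smul_comp_vecPart hf (hφ.fderiv_apply_const _), vecPart_single_succ]

/-! ### Weighted sums of normalised monomials -/

/-- `β_k(0) β_k(1) ⋯ β_k(b)`. -/
noncomputable def betaProd (m k b : ℕ) : ℝ := ∏ s ∈ range (b + 1), (beta m k s : ℝ)

theorem betaProd_zero (k : ℕ) : betaProd m k 0 = 1 := by simp [betaProd, beta]

theorem betaProd_succ (k b : ℕ) : betaProd m k (b + 1) = betaProd m k b * beta m k (b + 1) := by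
  rw [betaProd, prod_range_succ, betaProd]

theorem betaProd_ne_zero (hm : 0 < m) (k b : ℕ) : betaProd m k b ≠ 0 :=
  prod_ne_zero_iff.2 fun s _ => Nat.cast_ne_zero.2 (beta_pos hm k s).ne'

/-- `x̲^b P(x̲) / (β_k(0) ⋯ β_k(b))`, normalised so that the Laplacian lowers `b` by two up to
sign. -/
noncomputable def vecMonomial (k : ℕ) (P : EuclideanSpace ℝ (Fin m) → Cl m) (b : ℕ)
    (y : EuclideanSpace ℝ (Fin m)) : Cl m :=
  (betaProd m k b)⁻¹ • (Cl.vec y ^ b * P y)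

/-- `x_0^a / a!`. -/
noncomputable def divPow (a : ℕ) (t : ℝ) : ℝ := t ^ a / a.factorial

theorem contDiff_divPow (a : ℕ) : ContDiff ℝ ∞ (divPow a) := by
  unfold divPow; fun_prop

theorem deriv_divPow_zero : deriv (divPow 0) = 0 := by
  unfold divPow; ext t; simp

theorem deriv_divPow_succ (a : ℕ) : deriv (divPow (a + 1)) = divPow a := by
  unfold divPow
  ext t
  have := Nat.factorial_ne_zero a
  simp only [deriv_div_const, deriv_pow_field, Nat.factorial_succ, Nat.add_sub_cancel]
  push_cast
  field_simp

/-- `∑_{a+b=M} q(b) (x_0^a / a!) x̲^b P(x̲) / (β_k(0) ⋯ β_k(b))`. Up to a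
factorial, the Appell polynomial and the function `(x_0 + x̲)^N P(x̲)` have this form. -/
noncomputable def weightedSum (k : ℕ) (P : EuclideanSpace ℝ (Fin m) → Cl m) (q : ℕ → ℝ) (M : ℕ)
    (x : EuclideanSpace ℝ (Fin (m + 1))) : Cl m :=
  ∑ p ∈ antidiagonal M, q p.2 • divPow p.1 (x 0) • vecMonomial k P p.2 (vecPart x)

theorem weightedSum_const_mul {k : ℕ} {P : EuclideanSpace ℝ (Fin m) → Cl m} (c : ℝ)
    (q : ℕ → ℝ) (M : ℕ) (x : EuclideanSpace ℝ (Fin (m + 1))) :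
    weightedSum k P (fun b => c * q b) M x = c • weightedSum k P q M x := by
  simp [weightedSum, mul_smul, smul_sum]

theorem laplacian_const_smul {d : ℕ} {G : Type*} [NormedAddCommGroup G] [NormedSpace ℝ G]
    {g : EuclideanSpace ℝ (Fin d) → G} (hg : ContDiff ℝ ∞ g) (c : ℝ)
    (y : EuclideanSpace ℝ (Fin d)) : Δ (fun y => c • g y) y = c • Δ g y := by
  have h1 : ∀ y, DifferentiableAt ℝ g y := fun y => hg.differentiable (by simp) y
  have h2 : ∀ v y, DifferentiableAt ℝ (fun z => fderiv ℝ g z v) y := fun v y =>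
    (hg.fderiv_apply_const v).differentiable (by simp) y
  rw [laplacian_eq_sum_fderiv (hg.const_smul c), laplacian_eq_sum_fderiv hg, smul_sum]
  refine sum_congr rfl fun i _ => ?_
  simp [fderiv_fun_const_smul (h1 _), fderiv_fun_const_smul (h2 _ _)]

theorem laplacian_sum {d : ℕ} {G ι : Type*} [NormedAddCommGroup G] [NormedSpace ℝ G]
    {s : Finset ι} {g : ι → EuclideanSpace ℝ (Fin d) → G} (hg : ∀ i, ContDiff ℝ ∞ (g i))
    (y : EuclideanSpace ℝ (Fin d)) : Δ (fun y => ∑ i ∈ s, g i y) y = ∑ i ∈ s, Δ (g i) y := by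
  have h1 : ∀ i y, DifferentiableAt ℝ (g i) y := fun i y => (hg i).differentiable (by simp) y
  have h2 : ∀ v i y, DifferentiableAt ℝ (fun z => fderiv ℝ (g i) z v) y := fun v i y =>
    ((hg i).fderiv_apply_const v).differentiable (by simp) y
  rw [laplacian_eq_sum_fderiv (ContDiff.sum fun i _ => hg i)]
  simp only [laplacian_eq_sum_fderiv (hg _)]
  rw [sum_comm]
  refine sum_congr rfl fun j _ => ?_
  simp [fderiv_fun_sum fun i _ => h1 i _, fderiv_fun_sum fun i _ => h2 _ i _]

namespace IsHomogeneousMonogenic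

variable {k : ℕ} {P : EuclideanSpace ℝ (Fin m) → Cl m}

theorem contDiff_vecMonomial (hP : IsHomogeneousMonogenic k P) (b : ℕ) :
    ContDiff ℝ ∞ (vecMonomial k P b) :=
  (hP.contDiff_vec_pow_mul b).const_smul _

theorem laplacian_vecMonomial_zero (hP : IsHomogeneousMonogenic k P)
    (y : EuclideanSpace ℝ (Fin m)) : Δ (vecMonomial k P 0) y = 0 := by
  unfold vecMonomial
  rw [laplacian_const_smul (hP.contDiff_vec_pow_mul 0)]
  simp only [pow_zero, one_mul]
  rw [show (fun y => P y) = P from rfl, hP.laplacian_eq_zero, smul_zero]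

theorem laplacian_vecMonomial_one (hP : IsHomogeneousMonogenic k P)
    (y : EuclideanSpace ℝ (Fin m)) : Δ (vecMonomial k P 1) y = 0 := by
  unfold vecMonomial
  rw [laplacian_const_smul (hP.contDiff_vec_pow_mul 1)]
  simp only [pow_one]
  rw [hP.laplacian_vec_mul_eq_zero, smul_zero]

theorem laplacian_vecMonomial_add_two (hm : 0 < m) (hP : IsHomogeneousMonogenic k P) (b : ℕ)
    (y : EuclideanSpace ℝ (Fin m)) :
    Δ (vecMonomial k P (b + 2)) y = -vecMonomial k P b y := by
  have h0 := betaProd_ne_zero hm k b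
  have h1 : (beta m k (b + 1) : ℝ) ≠ 0 := Nat.cast_ne_zero.2 (beta_pos hm k _).ne'
  have h2 : (beta m k (b + 2) : ℝ) ≠ 0 := Nat.cast_ne_zero.2 (beta_pos hm k _).ne'
  unfold vecMonomial
  rw [laplacian_const_smul (hP.contDiff_vec_pow_mul _), hP.laplacian_vec_pow_add_two_mul,
    smul_neg, smul_smul, betaProd_succ, betaProd_succ]
  congr 2
  field_simp

/-- On weighted sums the Laplacian acts on the weights as minus the difference operator of
step two. -/
theorem laplacian_weightedSum (hm : 0 < m) (hP : IsHomogeneousMonogenic k P) (q : ℕ → ℝ) (M : ℕ) :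
    Δ (weightedSum k P q (M + 2)) = weightedSum k P (fun b => q b - q (b + 2)) M := by
  ext1 x
  have hsmooth : ∀ p : ℕ × ℕ, ContDiff ℝ ∞ fun x : EuclideanSpace ℝ (Fin (m + 1)) =>
      divPow p.1 (x 0) • vecMonomial k P p.2 (vecPart x) := fun p =>
    contDiff_smul_comp_vecPart (contDiff_divPow _) (hP.contDiff_vecMonomial _)
  have hsum : Δ (weightedSum k P q (M + 2)) x
      = ∑ p ∈ antidiagonal (M + 2),
          q p.2 • deriv (deriv (divPow p.1)) (x 0) • vecMonomial k P p.2 (vecPart x)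
        + ∑ p ∈ antidiagonal (M + 2),
          q p.2 • divPow p.1 (x 0) • Δ (vecMonomial k P p.2) (vecPart x) := by
    unfold weightedSum
    rw [laplacian_sum fun p : ℕ × ℕ => (hsmooth p).const_smul (q p.2), ← sum_add_distrib]
    refine sum_congr rfl fun p _ => ?_
    rw [laplacian_const_smul (hsmooth p), laplacian_smul_comp_vecPart (contDiff_divPow _)
      (hP.contDiff_vecMonomial _), smul_add]
  -- In the first sum the terms with `a < 2` vanish, in the second those with `b < 2`; splitting
  -- them off shifts both sums to total degree `M`.
  rw [hsum, Nat.sum_antidiagonal_succ, Nat.sum_antidiagonal_succ, Nat.sum_antidiagonal_succ',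
    Nat.sum_antidiagonal_succ']
  simp only [deriv_divPow_zero, zero_add, deriv_divPow_succ, hP.laplacian_vecMonomial_zero,
    hP.laplacian_vecMonomial_one, hP.laplacian_vecMonomial_add_two hm, weightedSum, add_assoc,
    Nat.reduceAdd, sub_smul, sum_sub_distrib]
  simp [sub_eq_add_neg]

/-- In terms of `⌈b/2⌉ = (b + 1) / 2` the difference operator of step two in `b` is the forward
difference of step one. -/
theorem iterate_laplacian_weightedSum (hm : 0 < m) (hP : IsHomogeneousMonogenic k P)
    (f : ℝ → ℝ) (l M : ℕ) :
    (Δ : (EuclideanSpace ℝ (Fin (m + 1)) → Cl m) → EuclideanSpace ℝ (Fin (m + 1)) → Cl m)^[l]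
        (weightedSum k P (fun b => f ((b + 1) / 2 : ℕ)) (M + 2 * l))
      = weightedSum k P (fun b => (-1) ^ l * (fwdDiff 1)^[l] f ((b + 1) / 2 : ℕ)) M := by
  induction l generalizing M with
  | zero => simp
  | succ l ih =>
    rw [Function.iterate_succ_apply', show M + 2 * (l + 1) = M + 2 + 2 * l by ring, ih,
      hP.laplacian_weightedSum hm]
    congr 1
    ext b
    rw [Function.iterate_succ_apply', fwdDiff, show (b + 2 + 1) / 2 = (b + 1) / 2 + 1 by omega]
    push_cast
    ring

end IsHomogeneousMonogenic

/-! ### Both sides of the theorem as weighted sums -/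

theorem appellM_eq_weightedSum (k n : ℕ) (P : EuclideanSpace ℝ (Fin m) → Cl m)
    (x : EuclideanSpace ℝ (Fin (m + 1))) :
    appellM k n P x = (n.factorial : ℝ) • weightedSum k P (fun _ => 1) n x := by
  rw [appellM, weightedSum, Nat.sum_antidiagonal_eq_sum_range_succ_mk, sum_mul, smul_sum]
  refine sum_congr rfl fun j hj => ?_
  have hj : j ≤ n := Nat.lt_succ_iff.1 (mem_range.1 hj)
  rw [smul_mul_assoc, vecMonomial, one_smul, smul_smul, smul_smul, appellCoeff, divPow, betaProd]
  congr 1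
  rw [← Nat.choose_mul_factorial_mul_factorial hj]
  have := Nat.factorial_ne_zero j
  push_cast
  field_simp

/-- Since `x̲² = -r²`, the function `u + (x̲/r) v` induced by `z^N` is `(x_0 + x̲)^N`. -/
theorem fueterInput_pow (N : ℕ) (P : EuclideanSpace ℝ (Fin m) → Cl m)
    (x : EuclideanSpace ℝ (Fin (m + 1))) :
    fueterInput (fun z => z ^ N) P x
      = (algebraMap ℝ (Cl m) (x 0) + Cl.vec (vecPart x)) ^ N * P (vecPart x) := by
  unfold fueterInput
  congr 1
  set r := ‖vecPart x‖ with hr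
  set v := Cl.vec (vecPart x) with hv
  set z : ℂ := ⟨x 0, r⟩ with hz
  -- This also holds for `r = 0`, where `v = 0` and `r⁻¹ = 0`.
  have hrv : r • r⁻¹ • v = v := by
    rcases eq_or_ne r 0 with h | h
    · have h0 : vecPart x = 0 := norm_eq_zero.1 h
      rw [hv, h0, ← Cl.vecL_apply, map_zero]; simp
    · rw [smul_smul, mul_inv_cancel₀ h, one_smul]
  have hrvv : r⁻¹ • (v * v) = algebraMap ℝ (Cl m) (-r) := by
    rw [hv, Cl.vec_mul_vec_self, ← hr, Algebra.algebraMap_eq_smul_one,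
      Algebra.algebraMap_eq_smul_one, smul_smul]
    congr 1
    rcases eq_or_ne r 0 with h | h
    · simp [h]
    · field_simp
  induction N with
  | zero => simp
  | succ N ih =>
    rw [pow_succ _ N, ← ih]
    set a := z ^ N
    have hre : (z ^ (N + 1)).re = a.re * x 0 - a.im * r := by rw [pow_succ, Complex.mul_re]
    have him : (z ^ (N + 1)).im = a.re * r + a.im * x 0 := by rw [pow_succ, Complex.mul_im]
    simp only [hre, him, add_mul, mul_add, smul_mul_assoc, hrvv, ← Algebra.smul_def, mul_smul,
      add_smul, hrv, map_sub, map_mul, ← Algebra.commutes (x 0)]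
    simp only [Algebra.algebraMap_eq_smul_one, smul_smul]
    module

theorem fueterInput_pow_eq_weightedSum (hm : 0 < m) (k N : ℕ)
    (P : EuclideanSpace ℝ (Fin m) → Cl m) (x : EuclideanSpace ℝ (Fin (m + 1))) :
    fueterInput (fun z => z ^ N) P x
      = (N.factorial : ℝ) • weightedSum k P (fun b => betaProd m k b / b.factorial) N x := by
  rw [fueterInput_pow, Commute.add_pow' (Algebra.commutes (x 0) (Cl.vec (vecPart x))),
    weightedSum, sum_mul, smul_sum]
  refine sum_congr rfl fun p hp => ?_
  obtain rfl : p.1 + p.2 = N := mem_antidiagonal.1 hp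
  rw [vecMonomial, smul_smul, smul_smul, smul_smul, ← map_pow, ← Algebra.smul_def,
    ← Nat.cast_smul_eq_nsmul ℝ, smul_smul, smul_mul_assoc, divPow]
  congr 1
  have h0 := betaProd_ne_zero hm k p.2
  have h1 := Nat.factorial_ne_zero p.1
  have h2 := Nat.factorial_ne_zero p.2
  rw [← Nat.add_choose_mul_factorial_mul_factorial, Nat.choose_symm_add]
  push_cast
  field_simp

/-! ### The weights as values of a polynomial -/

open Polynomial in
/-- The polynomial `∏_{l<h} (2t + 2l + 1) / (2l + 1)` of degree `h` in `t`. -/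
noncomputable def weightPoly (h : ℕ) : ℝ[X] :=
  ∏ l ∈ range h, (C (2 / (2 * l + 1 : ℝ)) * X + C 1)

theorem eval_weightPoly (h : ℕ) (t : ℝ) :
    (weightPoly h).eval t = ∏ l ∈ range h, (2 * t + (2 * l + 1)) / (2 * l + 1) := by
  rw [weightPoly, Polynomial.eval_prod]
  refine prod_congr rfl fun l _ => ?_
  have : (2 * l + 1 : ℝ) ≠ 0 := by positivity
  simp
  field_simp

theorem natDegree_weightPoly (h : ℕ) : (weightPoly h).natDegree = h := by
  have hl : ∀ l : ℕ, (2 / (2 * l + 1 : ℝ)) ≠ 0 := fun l => by positivity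
  rw [weightPoly, Polynomial.natDegree_prod _ _ fun l _ =>
    Polynomial.leadingCoeff_ne_zero.1 (by rw [Polynomial.leadingCoeff_linear (hl l)]; exact hl l)]
  simp only [Polynomial.natDegree_linear (hl _)]
  simp

theorem leadingCoeff_weightPoly_ne_zero (h : ℕ) : (weightPoly h).leadingCoeff ≠ 0 := by
  rw [weightPoly, Polynomial.leadingCoeff_prod]
  refine prod_ne_zero_iff.2 fun l _ => ?_
  have hl : (2 / (2 * l + 1 : ℝ)) ≠ 0 := by positivity
  rwa [Polynomial.leadingCoeff_linear hl]

/-- The value at `t + 1` is the value at `t` times `(2t + 2h + 1) / (2t + 1)`, because the product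
telescopes. -/
theorem eval_weightPoly_add_one (h : ℕ) (t : ℕ) :
    (2 * t + 1) * (weightPoly h).eval (t + 1 : ℝ)
      = (2 * t + 2 * h + 1) * (weightPoly h).eval (t : ℝ) := by
  simp only [eval_weightPoly]
  induction h with
  | zero => simp
  | succ h ih =>
    rw [prod_range_succ, prod_range_succ, ← mul_assoc, ih]
    push_cast
    have : (2 * h + 1 : ℝ) ≠ 0 := by positivity
    field_simp
    ring

/-- From `b = 2t` to `2t + 1` the left side gains the factor `(2t + 2h + 1) / (2t + 1)`, from
`2t + 1` to `2t + 2` the factor `1`. -/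
theorem betaProd_div_factorial {k h : ℕ} (hh : 2 * k + m = 2 * h + 1) (b : ℕ) :
    betaProd m k b / b.factorial = (weightPoly h).eval (((b + 1) / 2 : ℕ) : ℝ) := by
  induction b with
  | zero =>
    have : ∀ l : ℕ, (2 * l + 1 : ℝ) ≠ 0 := fun l => by positivity
    simp [betaProd_zero, eval_weightPoly, this]
  | succ b ih =>
    have hf : ((b + 1 : ℕ) : ℝ) ≠ 0 := Nat.cast_ne_zero.2 b.succ_ne_zero
    have hstep : betaProd m k (b + 1) / (b + 1).factorial
        = beta m k (b + 1) / (b + 1 : ℕ) * (betaProd m k b / b.factorial) := by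
      have := Nat.factorial_ne_zero b
      rw [betaProd_succ, Nat.factorial_succ, Nat.cast_mul]
      field_simp
    rw [hstep, ih]
    rcases Nat.even_or_odd' b with ⟨t, rfl | rfl⟩
    · have hb : beta m k (2 * t + 1) = 2 * t + 2 * h + 1 := by
        simp [beta]; omega
      rw [hb, show (2 * t + 1) / 2 = t by omega, show (2 * t + 1 + 1) / 2 = t + 1 by omega,
        div_mul_eq_mul_div, div_eq_iff hf]
      have := eval_weightPoly_add_one h t
      push_cast
      linarith
    · have hb : beta m k (2 * t + 1 + 1) = 2 * t + 1 + 1 := by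
        have : Even (2 * t + 1 + 1) := ⟨t + 1, by ring⟩
        simp [beta, this]
      rw [hb, div_self hf, one_mul, show (2 * t + 1 + 1 + 1) / 2 = (2 * t + 1 + 1) / 2 by omega]

/-! ### Fueter's theorem and the Appell polynomials -/

theorem mainTheorem2 (m : ℕ) (hm : Odd m) (k n : ℕ) :
    ∃ c : ℝ, c ≠ 0 ∧
      ∀ P : EuclideanSpace ℝ (Fin m) → Cl m, IsHomogeneousMonogenic k P →
        ∀ x : EuclideanSpace ℝ (Fin (m + 1)),
          appellM k n P x = c • fueter k (fun z : ℂ => z ^ (n + 2 * k + m - 1)) P x := by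
  obtain ⟨d, rfl⟩ := hm
  have hm' : 0 < 2 * d + 1 := by omega
  set h := k + d with hh
  have hN : n + 2 * k + (2 * d + 1) - 1 = n + 2 * h := by omega
  have hpow : k + (2 * d + 1 - 1) / 2 = h := by omega
  -- `κ` is `N!` times the factor by which `Δ^h` turns the weights into the constant weight `1`.
  set κ : ℝ := (n + 2 * h).factorial * ((-1) ^ h * ((weightPoly h).leadingCoeff * h.factorial))
    with hκ
  have hκ0 : κ ≠ 0 := by
    have h1 : (weightPoly h).leadingCoeff ≠ 0 := leadingCoeff_weightPoly_ne_zero h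
    have h2 := Nat.factorial_ne_zero
    simp [hκ, h1, h2]
  refine ⟨n.factorial * κ⁻¹, mul_ne_zero (Nat.cast_ne_zero.2 n.factorial_ne_zero)
    (inv_ne_zero hκ0), fun P hP x => ?_⟩
  have hinput : fueterInput (fun z => z ^ (n + 2 * h)) P = weightedSum k P
      (fun b => ((n + 2 * h).factorial • (weightPoly h).eval) (((b + 1) / 2 : ℕ) : ℝ))
      (n + 2 * h) := by
    ext1 x
    rw [fueterInput_pow_eq_weightedSum hm' k, ← weightedSum_const_mul]
    congr 1
    ext b
    rw [betaProd_div_factorial (h := h) (by omega) b]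
    simp
  have hfueter : fueter k (fun z : ℂ => z ^ (n + 2 * h)) P x
      = κ • weightedSum k P (fun _ => 1) n x := by
    rw [fueter, hpow, hinput, hP.iterate_laplacian_weightedSum hm', ← weightedSum_const_mul]
    congr 1
    ext b
    have hdiff : (fwdDiff (1 : ℝ))^[h] (weightPoly h).eval
        = fun _ => (weightPoly h).leadingCoeff * h.factorial := by
      have := (weightPoly h).fwdDiff_iter_degree_eq_factorial
      rw [natDegree_weightPoly] at this
      rw [this]
      ext; simp
    rw [fwdDiff_iter_const_smul, hdiff, hκ]
    simp
    ring
  rw [hN, hfueter, appellM_eq_weightedSum, smul_smul, mul_assoc, inv_mul_cancel₀ hκ0, mul_one]
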